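/- Let $\mathbb K$ be a field of characteristic $0$ and let $k\ge 2$. Let $E$ be a right $\mathbb K[\mathbb S_k]$-module, let $\mathbb T(E)$ be the free symmetric operad on the $\mathbb S$-module that is $E$ in arity $k$ and $0$ in all other arities, let $R\subseteq \mathbb T(E)(2k-1)$ be an $\mathbb S_{2k-1}$-submodule, let $(R)$ be the operadic ideal it generates, and let $\mathcal P=\mathbb T(E)/(R)$ be the corresponding $k$-ary quadratic operad. Let $\mathfrak a$ be a finite-dimensional $\mathcal P$-algebra, with structure morphism $\gamma:\mathcal P\to \mathrm{End}_{\mathfrak a}$ and vector space basis $a_1,\dots,a_n$. For $\mu\in\mathcal P(m)$ define scalars by $$\gamma_m(\mu)(a_{i_1},\dots,a_{i_m})=\sum_{s=1}^n \alpha^s_{\gamma_m(\mu),i_1,\dots,i_m}\,a_s ,$$ and for $1\le a,i_1,\dots,i_m\le n$ define the universal polynomial $$P_{(\mu,a,i_1,\dots,i_m)}=\sum_{u=1}^n \alpha^u_{\gamma_m(\mu),i_1,\dots,i_m}X_{au}-\sum_{s_1,\dots,s_m=1}^n \alpha^a_{\gamma_m(\mu),s_1,\dots,s_m}X_{s_1i_1}\cdots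 X_{s_mi_m}$$ in $\mathbb K[X_{si}\mid 1\le s,i\le n]$. Let $J$ be the ideal generated by the polynomials $P_{(\mu,a,i_1,\dots,i_m)}$ for all $m\in\mathbb N$, all $\mu\in\mathcal P(m)$ and all $a,i_1,\dots,i_m$, so that $\mathcal C(\mathfrak a)=\mathbb K[X_{si}]/J$ is the universal algebra of $\mathfrak a$. Then the canonical map $E\to\mathcal P(k)$ is bijective, and for every basis $B$ of $\mathcal P(k)\cong E$ the ideal $J$ is generated by the polynomials $P_{(\mu,a,i_1,\dots,i_k)}$ with $\mu\in B$ and $1\le a,i_1,\dots,i_k\le n$. -/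

import Mathlib

open MulOpposite

universe u v w

/-! ### Positions in a partial composite

`m`, `n` are the arities of `μ`, `ν`, and `p = m - 1 + n` is the arity of `μ ∘ᵢ ν`. The equation is
kept as the hypothesis `p + 1 = m + n`, so that no transport between arities is ever needed.
All inputs are numbered from `0`. -/

/-- The input of `μ ∘ᵢ ν` that is the input `l` of `ν`. -/
def innerPos {m n p : ℕ} (h : p + 1 = m + n) (i : Fin m) (l : Fin n) : Fin p :=
  ⟨i + l, by omega⟩

/-- The input of `μ ∘ᵢ ν` that is the input `j ≠ i` of `μ`. -/
def outerPos {m n p : ℕ} (h : p + 1 = m + n) (i j : Fin m) (hj : j ≠ i) : Fin p :=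
  ⟨if j < i then j else j + n - 1, by
    have : (j : ℕ) ≠ i := fun e => hj (Fin.ext e)
    split_ifs with h' <;> simp only [Fin.lt_def] at h' <;> omega⟩

theorem innerPos_injective {m n p : ℕ} (h : p + 1 = m + n) (i : Fin m) :
    Function.Injective (innerPos h i) := by
  intro a b hab
  simp only [innerPos, Fin.mk.injEq] at hab
  exact Fin.ext (by omega)

theorem outerPos_inj {m n p : ℕ} (h : p + 1 = m + n) (i j j' : Fin m) (hj : j ≠ i) (hj' : j' ≠ i)
    (e : outerPos h i j hj = outerPos h i j' hj') : j = j' := by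
  have h1 : (j : ℕ) ≠ i := fun e => hj (Fin.ext e)
  have h2 : (j' : ℕ) ≠ i := fun e => hj' (Fin.ext e)
  simp only [outerPos, Fin.mk.injEq, Fin.lt_def] at e
  apply Fin.ext
  split_ifs at e <;> omega

theorem innerPos_ne_outerPos {m n p : ℕ} (h : p + 1 = m + n) (i j : Fin m) (hj : j ≠ i)
    (l : Fin n) : innerPos h i l ≠ outerPos h i j hj := by
  have h1 : (j : ℕ) ≠ i := fun e => hj (Fin.ext e)
  intro e
  simp only [innerPos, outerPos, Fin.mk.injEq, Fin.lt_def] at e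
  split_ifs at e <;> omega

theorem exists_pos {m n p : ℕ} (h : p + 1 = m + n) (i : Fin m) (q : Fin p) :
    (∃ l, q = innerPos h i l) ∨ ∃ j hj, q = outerPos h i j hj := by
  by_cases h1 : (q : ℕ) < i
  · refine Or.inr ⟨⟨q, by omega⟩, fun e => ?_, ?_⟩
    · rw [← e] at h1
      simp at h1
    · apply Fin.ext
      simp [outerPos, Fin.lt_def, h1]
  · by_cases h2 : (q : ℕ) < i + n
    · exact Or.inl ⟨⟨q - i, by omega⟩, Fin.ext (by simp only [innerPos]; omega)⟩
    · refine Or.inr ⟨⟨q + 1 - n, by omega⟩, fun e => ?_, ?_⟩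
      · have := congrArg Fin.val e
        simp only at this
        omega
      · apply Fin.ext
        have h3 : ¬ ((q : ℕ) + 1 - n < i) := by omega
        simp only [outerPos, Fin.lt_def, h3, if_false]
        omega

/-- The inputs of `μ ∘ᵢ ν` are those of `μ` other than `i`, and those of `ν`. -/
noncomputable def blockEquiv {m n p : ℕ} (h : p + 1 = m + n) (i : Fin m) :
    {j : Fin m // j ≠ i} ⊕ Fin n ≃ Fin p :=
  Equiv.ofBijective (Sum.elim (fun j => outerPos h i j j.2) (innerPos h i)) (by
    constructor
    · rintro (⟨a, ha⟩ | a) (⟨b, hb⟩ | b) hab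
      · exact congrArg Sum.inl (Subtype.ext (outerPos_inj h i a b ha hb hab))
      · exact absurd hab.symm (innerPos_ne_outerPos h i a ha b)
      · exact absurd hab (innerPos_ne_outerPos h i b hb a)
      · exact congrArg Sum.inr (innerPos_injective h i hab)
    · intro q
      rcases exists_pos h i q with ⟨l, rfl⟩ | ⟨j, hj, rfl⟩
      · exact ⟨Sum.inr l, rfl⟩
      · exact ⟨Sum.inl ⟨j, hj⟩, rfl⟩)

/-- The block permutation `σ ∘ᵢ τ`: `σ` with its entry at `i` replaced by the block `τ`. The inputs
outside of the block are moved by `σ`; the block at `i` is moved to the block at `σ i`, and is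
permuted inside by `τ`. -/
noncomputable def blockPerm {m n p : ℕ} (h : p + 1 = m + n) (i : Fin m)
    (σ : Equiv.Perm (Fin m)) (τ : Equiv.Perm (Fin n)) : Equiv.Perm (Fin p) :=
  (blockEquiv h i).symm.trans
    ((Equiv.sumCongr (σ.subtypeEquiv fun j => (σ.injective.ne_iff (x := j) (y := i)).symm) τ).trans
      (blockEquiv h (σ i)))

theorem blockPerm_inner {m n p : ℕ} (h : p + 1 = m + n) (i : Fin m)
    (σ : Equiv.Perm (Fin m)) (τ : Equiv.Perm (Fin n)) (l : Fin n) :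
    blockPerm h i σ τ (innerPos h i l) = innerPos h (σ i) (τ l) := by
  have : (blockEquiv h i).symm (innerPos h i l) = Sum.inr l := by
    rw [Equiv.symm_apply_eq]; rfl
  simp only [blockPerm, Equiv.trans_apply, this]
  rfl

theorem blockPerm_outer {m n p : ℕ} (h : p + 1 = m + n) (i : Fin m)
    (σ : Equiv.Perm (Fin m)) (τ : Equiv.Perm (Fin n)) (j : Fin m) (hj : j ≠ i) :
    blockPerm h i σ τ (outerPos h i j hj) = outerPos h (σ i) (σ j) (σ.injective.ne hj) := by
  have : (blockEquiv h i).symm (outerPos h i j hj) = Sum.inl ⟨j, hj⟩ := by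
    rw [Equiv.symm_apply_eq]; rfl
  simp only [blockPerm, Equiv.trans_apply, this]
  rfl

/-! ### Operads and their morphisms -/

/-- A (symmetric) operad over `K`, by partial compositions. A right action of `𝕊ₙ` is a
representation of the opposite group. The law `parallel` holds for `i < j` and for `j < i`, and so
covers both the first and the third case of the usual associativity law; `sequential` is the second
case. -/
structure SymmOperad (K : Type u) [Field K] where
  obj : ℕ → Type v
  [addCommGroup : ∀ n, AddCommGroup (obj n)]
  [module : ∀ n, Module K (obj n)]
  act : ∀ n, Representation K (Equiv.Perm (Fin n))ᵐᵒᵖ (obj n)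
  unit : obj 1
  comp : ∀ {m n p : ℕ}, p + 1 = m + n → Fin m → (obj m →ₗ[K] obj n →ₗ[K] obj p)
  comp_unit : ∀ {m : ℕ} (h : m + 1 = m + 1) (i : Fin m) (μ : obj m), comp h i μ unit = μ
  unit_comp : ∀ {n : ℕ} (h : n + 1 = 1 + n) (ν : obj n), comp h 0 unit ν = ν
  sequential : ∀ {m n r p q s : ℕ} (h₁ : p + 1 = m + n) (h₂ : s + 1 = p + r)
    (h₃ : q + 1 = n + r) (h₄ : s + 1 = m + q) (i : Fin m) (l : Fin n)
    (μ : obj m) (ν : obj n) (ξ : obj r),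
    comp h₂ (innerPos h₁ i l) (comp h₁ i μ ν) ξ = comp h₄ i μ (comp h₃ l ν ξ)
  parallel : ∀ {m n r p q s : ℕ} (h₁ : p + 1 = m + n) (h₂ : s + 1 = p + r)
    (h₃ : q + 1 = m + r) (h₄ : s + 1 = q + n) (i j : Fin m) (hij : i ≠ j)
    (μ : obj m) (ν : obj n) (ξ : obj r),
    comp h₂ (outerPos h₁ i j hij.symm) (comp h₁ i μ ν) ξ =
      comp h₄ (outerPos h₃ j i hij) (comp h₃ j μ ξ) ν
  equivariant : ∀ {m n p : ℕ} (h : p + 1 = m + n) (i : Fin m)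
    (σ : Equiv.Perm (Fin m)) (τ : Equiv.Perm (Fin n)) (μ : obj m) (ν : obj n),
    comp h i (act m (op σ) μ) (act n (op τ) ν) =
      act p (op (blockPerm h i σ τ)) (comp h (σ i) μ ν)

attribute [instance] SymmOperad.addCommGroup SymmOperad.module

/-- A morphism of operads. -/
structure OperadHom {K : Type u} [Field K] (P : SymmOperad.{u, v} K) (Q : SymmOperad.{u, w} K) where
  map : ∀ n, P.obj n →ₗ[K] Q.obj n
  map_unit : map 1 P.unit = Q.unit
  map_comp : ∀ {m n p : ℕ} (h : p + 1 = m + n) (i : Fin m) (μ : P.obj m) (ν : P.obj n),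
    map p (P.comp h i μ ν) = Q.comp h i (map m μ) (map n ν)
  map_act : ∀ {n : ℕ} (σ : Equiv.Perm (Fin n)) (μ : P.obj n),
    map n (P.act n (op σ) μ) = Q.act n (op σ) (map n μ)

/-! ### The endomorphism operad -/

/-- The arguments of `f` in `(f ∘ᵢ g)(v)`: the value of `g` at the block of `v` that starts at `i`
stands at place `i`, and the other entries of `v` stand around it. -/
def endArgs {A : Type w} {m n p : ℕ} (h : p + 1 = m + n) (i : Fin m) (g : (Fin n → A) → A)
    (v : Fin p → A) (j : Fin m) : A :=
  if hj : j = i then g fun l => v (innerPos h i l) else v (outerPos h i j hj)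

theorem endArgs_same {A : Type w} {m n p : ℕ} (h : p + 1 = m + n) (i : Fin m)
    (g : (Fin n → A) → A) (v : Fin p → A) :
    endArgs h i g v i = g fun l => v (innerPos h i l) := by
  simp [endArgs]

theorem endArgs_ne {A : Type w} {m n p : ℕ} (h : p + 1 = m + n) (i : Fin m)
    (g : (Fin n → A) → A) (v : Fin p → A) (j : Fin m) (hj : j ≠ i) :
    endArgs h i g v j = v (outerPos h i j hj) := by
  simp [endArgs, hj]

theorem endArgs_update_inner {A : Type w} {m n p : ℕ} (h : p + 1 = m + n) (i : Fin m)
    (g : (Fin n → A) → A) (v : Fin p → A) (l : Fin n) (x : A) :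
    endArgs h i g (Function.update v (innerPos h i l) x) =
      Function.update (endArgs h i g v) i
        (g (Function.update (fun l => v (innerPos h i l)) l x)) := by
  funext j
  by_cases hj : j = i
  · subst hj
    rw [endArgs_same, Function.update_self]
    congr 1
    funext l'
    by_cases hl : l' = l
    · subst hl; simp
    · rw [Function.update_of_ne hl, Function.update_of_ne]
      exact fun e => hl (innerPos_injective h j e)
  · rw [endArgs_ne _ _ _ _ _ hj, Function.update_of_ne hj, endArgs_ne _ _ _ _ _ hj,
      Function.update_of_ne (innerPos_ne_outerPos h i j hj l).symm]

theorem endArgs_update_outer {A : Type w} {m n p : ℕ} (h : p + 1 = m + n) (i : Fin m)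
    (g : (Fin n → A) → A) (v : Fin p → A) (j : Fin m) (hj : j ≠ i) (x : A) :
    endArgs h i g (Function.update v (outerPos h i j hj) x) =
      Function.update (endArgs h i g v) j x := by
  funext j'
  by_cases hj' : j' = i
  · subst hj'
    rw [endArgs_same, Function.update_of_ne hj.symm, endArgs_same]
    congr 1
    funext l
    exact Function.update_of_ne (innerPos_ne_outerPos h j' j hj l) _ _
  · rw [endArgs_ne _ _ _ _ _ hj']
    by_cases hjj : j' = j
    · subst hjj; simp
    · rw [Function.update_of_ne hjj, endArgs_ne _ _ _ _ _ hj', Function.update_of_ne]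
      exact fun e => hjj (outerPos_inj h i j' j hj' hj e)

/-- Partial composition of multilinear maps,
`(f ∘ᵢ g)(v) = f (v₀, …, vᵢ₋₁, g (vᵢ, …, vᵢ₊ₙ₋₁), vᵢ₊ₙ, …)`. -/
def endComp (K : Type u) [Field K] {A : Type w} [AddCommGroup A] [Module K A] {m n p : ℕ}
    (h : p + 1 = m + n) (i : Fin m) (f : MultilinearMap K (fun _ : Fin m => A) A)
    (g : MultilinearMap K (fun _ : Fin n => A) A) : MultilinearMap K (fun _ : Fin p => A) A :=
  MultilinearMap.mk' (fun v => f (endArgs h i g v))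
    (by
      intro v q x y
      rcases exists_pos h i q with ⟨l, rfl⟩ | ⟨j, hj, rfl⟩
      · simp only [endArgs_update_inner, MultilinearMap.map_update_add]
      · simp only [endArgs_update_outer, MultilinearMap.map_update_add])
    (by
      intro v q c x
      rcases exists_pos h i q with ⟨l, rfl⟩ | ⟨j, hj, rfl⟩
      · simp only [endArgs_update_inner, MultilinearMap.map_update_smul]
      · simp only [endArgs_update_outer, MultilinearMap.map_update_smul])

theorem endComp_apply (K : Type u) [Field K] {A : Type w} [AddCommGroup A] [Module K A]
    {m n p : ℕ} (h : p + 1 = m + n) (i : Fin m) (f : MultilinearMap K (fun _ : Fin m => A) A)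
    (g : MultilinearMap K (fun _ : Fin n => A) A) (v : Fin p → A) :
    endComp K h i f g v = f (endArgs h i g v) := rfl

theorem endArgs_eq_update {A : Type w} {m n p : ℕ} (h : p + 1 = m + n) (i : Fin m)
    (g g' : (Fin n → A) → A) (v : Fin p → A) :
    endArgs h i g v = Function.update (endArgs h i g' v) i (g fun l => v (innerPos h i l)) := by
  funext j
  by_cases hj : j = i
  · subst hj; simp [endArgs_same]
  · rw [Function.update_of_ne hj, endArgs_ne _ _ _ _ _ hj, endArgs_ne _ _ _ _ _ hj]

/-- The endomorphism operad: `End_A(n)` is the space of `n`-linear maps `Aⁿ → A`, and the right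
action is `(f · σ)(v₁, …, vₙ) = f (v_{σ⁻¹(1)}, …, v_{σ⁻¹(n)})`. -/
def endOperad (K : Type u) [Field K] (A : Type w) [AddCommGroup A] [Module K A] :
    SymmOperad.{u, w} K where
  obj n := MultilinearMap K (fun _ : Fin n => A) A
  act n :=
    { toFun := fun σ =>
        { toFun := fun f => f.domDomCongr (unop σ)⁻¹
          map_add' := fun _ _ => rfl
          map_smul' := fun _ _ => rfl }
      map_one' := rfl
      map_mul' := fun _ _ => rfl }
  unit := MultilinearMap.ofSubsingleton K A A (0 : Fin 1) LinearMap.id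
  comp h i := LinearMap.mk₂ K (endComp K h i)
    (fun _ _ _ => rfl) (fun _ _ _ => rfl)
    (fun f g g' => by
      ext v
      simp only [endComp_apply, add_apply]
      rw [endArgs_eq_update h i (⇑(g + g')) (fun _ => 0), endArgs_eq_update h i (⇑g) (fun _ => 0),
        endArgs_eq_update h i (⇑g') (fun _ => 0), ← MultilinearMap.map_update_add]
      rfl)
    (fun c f g => by
      ext v
      simp only [endComp_apply, smul_apply]
      rw [endArgs_eq_update h i (⇑(c • g)) (fun _ => 0), endArgs_eq_update h i (⇑g) (fun _ => 0),
        ← MultilinearMap.map_update_smul]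
      rfl)
  comp_unit h i f := by
    refine MultilinearMap.ext fun v => ?_
    change f (endArgs h i (fun w => w 0) v) = f v
    congr 1
    funext j
    by_cases hj : j = i
    · subst hj
      simp only [endArgs_same]
      exact congrArg v (Fin.ext (by simp [innerPos]))
    · rw [endArgs_ne _ _ _ _ _ hj]
      have : (j : ℕ) ≠ i := fun e => hj (Fin.ext e)
      exact congrArg v (Fin.ext (by simp [outerPos]))
  unit_comp h g := by
    refine MultilinearMap.ext fun v => ?_
    change endArgs h 0 g v 0 = g v
    rw [endArgs_same]
    congr 1
    funext l
    exact congrArg v (Fin.ext (by simp [innerPos]))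
  sequential h₁ h₂ h₃ h₄ i l f g e := by
    refine MultilinearMap.ext fun v => ?_
    change f (endArgs h₁ i g (endArgs h₂ (innerPos h₁ i l) e v)) =
      f (endArgs h₄ i (endComp K h₃ l g e) v)
    congr 1
    funext j
    by_cases hj : j = i
    · subst hj
      simp only [endArgs_same, endComp_apply]
      congr 1
      funext a
      by_cases ha : a = l
      · subst ha
        simp only [endArgs_same]
        congr 1
        funext b
        exact congrArg v (Fin.ext (by simp [innerPos, add_assoc]))
      · have hne : (a : ℕ) ≠ l := fun e => ha (Fin.ext e)
        rw [endArgs_ne _ _ _ _ _ ((innerPos_injective h₁ j).ne ha), endArgs_ne _ _ _ _ _ ha]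
        refine congrArg v (Fin.ext ?_)
        simp only [innerPos, outerPos, Fin.lt_def]
        split_ifs <;> omega
    · have hne : (j : ℕ) ≠ i := fun e => hj (Fin.ext e)
      rw [endArgs_ne _ _ _ _ _ hj, endArgs_ne _ _ _ _ _ hj,
        endArgs_ne _ _ _ _ _ (innerPos_ne_outerPos h₁ i j hj l).symm]
      refine congrArg v (Fin.ext ?_)
      simp only [innerPos, outerPos, Fin.lt_def]
      split_ifs <;> omega
  parallel h₁ h₂ h₃ h₄ i j hij f g e := by
    have hne : (i : ℕ) ≠ j := fun e => hij (Fin.ext e)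
    refine MultilinearMap.ext fun v => ?_
    change f (endArgs h₁ i g (endArgs h₂ (outerPos h₁ i j hij.symm) e v)) =
      f (endArgs h₃ j e (endArgs h₄ (outerPos h₃ j i hij) g v))
    congr 1
    funext a
    by_cases hai : a = i
    · subst hai
      rw [endArgs_same, endArgs_ne _ _ _ _ _ hij, endArgs_same]
      congr 1
      funext l
      rw [endArgs_ne _ _ _ _ _ (innerPos_ne_outerPos h₁ a j hij.symm l)]
      refine congrArg v (Fin.ext ?_)
      simp only [innerPos, outerPos, Fin.lt_def]
      split_ifs <;> omega
    · have hne1 : (a : ℕ) ≠ i := fun e => hai (Fin.ext e)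
      rw [endArgs_ne _ _ _ _ _ hai]
      by_cases haj : a = j
      · subst haj
        rw [endArgs_same, endArgs_same]
        congr 1
        funext l
        rw [endArgs_ne _ _ _ _ _ (innerPos_ne_outerPos h₃ a i hij l)]
        refine congrArg v (Fin.ext ?_)
        simp only [innerPos, outerPos, Fin.lt_def]
        split_ifs <;> omega
      · have hne2 : (a : ℕ) ≠ j := fun e => haj (Fin.ext e)
        rw [endArgs_ne _ _ _ _ _ haj,
          endArgs_ne _ _ _ _ _ (fun e => haj (outerPos_inj h₁ i a j hai hij.symm e)),
          endArgs_ne _ _ _ _ _ (fun e => hai (outerPos_inj h₃ j a i haj hij e))]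
        refine congrArg v (Fin.ext ?_)
        simp only [outerPos, Fin.lt_def]
        split_ifs <;> omega
  equivariant h i σ τ f g := by
    ext v
    change f (fun j => endArgs h i (fun w => g fun l => w (τ.symm l)) v (σ.symm j)) =
      f (endArgs h (σ i) g fun q => v ((blockPerm h i σ τ).symm q))
    congr 1
    funext j
    obtain ⟨j, rfl⟩ := σ.surjective j
    rw [Equiv.symm_apply_apply]
    by_cases hj : j = i
    · subst hj
      rw [endArgs_same, endArgs_same]
      congr 1
      funext l
      obtain ⟨l, rfl⟩ := τ.surjective l
      rw [← blockPerm_inner, Equiv.symm_apply_apply, Equiv.symm_apply_apply]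
    · rw [endArgs_ne _ _ _ _ _ hj, endArgs_ne _ _ _ _ _ (σ.injective.ne hj), ← blockPerm_outer,
        Equiv.symm_apply_apply]

/-! ### The free operad on a right `𝕊ₖ`-module in arity `k` -/

/-- Formal operadic expressions, by arity, in the elements of `E` as `k`-ary operations. -/
inductive FreeTerm (K : Type u) (E : Type v) (k : ℕ) : ℕ → Type (max u v)
  | gen (e : E) : FreeTerm K E k k
  | unit : FreeTerm K E k 1
  | comp {m n p : ℕ} (h : p + 1 = m + n) (i : Fin m) (s : FreeTerm K E k m)
      (t : FreeTerm K E k n) : FreeTerm K E k p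
  | act {n : ℕ} (σ : Equiv.Perm (Fin n)) (t : FreeTerm K E k n) : FreeTerm K E k n
  | zero (n : ℕ) : FreeTerm K E k n
  | add {n : ℕ} (s t : FreeTerm K E k n) : FreeTerm K E k n
  | smul {n : ℕ} (c : K) (t : FreeTerm K E k n) : FreeTerm K E k n

/-- The congruence on formal expressions that is generated by the laws of vector spaces, the laws of
operads, and the linear structure and the right action of `𝕊ₖ` on `E`. -/
inductive FreeRel {K : Type u} [Field K] {E : Type v} [AddCommGroup E] [Module K E] {k : ℕ}
    (ρ : Representation K (Equiv.Perm (Fin k))ᵐᵒᵖ E) :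
    ∀ {n : ℕ}, FreeTerm K E k n → FreeTerm K E k n → Prop
  -- equivalence relation
  | refl {n : ℕ} (s : FreeTerm K E k n) : FreeRel ρ s s
  | symm {n : ℕ} {s t : FreeTerm K E k n} : FreeRel ρ s t → FreeRel ρ t s
  | trans {n : ℕ} {s t r : FreeTerm K E k n} : FreeRel ρ s t → FreeRel ρ t r → FreeRel ρ s r
  -- compatible with all operations
  | congr_comp {m n p : ℕ} (h : p + 1 = m + n) (i : Fin m) {s s' : FreeTerm K E k m}
      {t t' : FreeTerm K E k n} : FreeRel ρ s s' → FreeRel ρ t t' →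
      FreeRel ρ (.comp h i s t) (.comp h i s' t')
  | congr_act {n : ℕ} (σ : Equiv.Perm (Fin n)) {s t : FreeTerm K E k n} :
      FreeRel ρ s t → FreeRel ρ (.act σ s) (.act σ t)
  | congr_add {n : ℕ} {s s' t t' : FreeTerm K E k n} : FreeRel ρ s s' → FreeRel ρ t t' →
      FreeRel ρ (.add s t) (.add s' t')
  | congr_smul {n : ℕ} (c : K) {s t : FreeTerm K E k n} :
      FreeRel ρ s t → FreeRel ρ (.smul c s) (.smul c t)
  -- vector space laws
  | add_comm {n : ℕ} (s t : FreeTerm K E k n) : FreeRel ρ (.add s t) (.add t s)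
  | add_assoc {n : ℕ} (s t r : FreeTerm K E k n) :
      FreeRel ρ (.add (.add s t) r) (.add s (.add t r))
  | zero_add {n : ℕ} (s : FreeTerm K E k n) : FreeRel ρ (.add (.zero n) s) s
  | zero_smul {n : ℕ} (s : FreeTerm K E k n) : FreeRel ρ (.smul 0 s) (.zero n)
  | one_smul {n : ℕ} (s : FreeTerm K E k n) : FreeRel ρ (.smul 1 s) s
  | mul_smul {n : ℕ} (c d : K) (s : FreeTerm K E k n) :
      FreeRel ρ (.smul (c * d) s) (.smul c (.smul d s))
  | add_smul {n : ℕ} (c d : K) (s : FreeTerm K E k n) :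
      FreeRel ρ (.smul (c + d) s) (.add (.smul c s) (.smul d s))
  | smul_add {n : ℕ} (c : K) (s t : FreeTerm K E k n) :
      FreeRel ρ (.smul c (.add s t)) (.add (.smul c s) (.smul c t))
  -- linearity of the operations
  | comp_add_left {m n p : ℕ} (h : p + 1 = m + n) (i : Fin m) (s s' : FreeTerm K E k m)
      (t : FreeTerm K E k n) :
      FreeRel ρ (.comp h i (.add s s') t) (.add (.comp h i s t) (.comp h i s' t))
  | comp_smul_left {m n p : ℕ} (h : p + 1 = m + n) (i : Fin m) (c : K) (s : FreeTerm K E k m)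
      (t : FreeTerm K E k n) :
      FreeRel ρ (.comp h i (.smul c s) t) (.smul c (.comp h i s t))
  | comp_add_right {m n p : ℕ} (h : p + 1 = m + n) (i : Fin m) (s : FreeTerm K E k m)
      (t t' : FreeTerm K E k n) :
      FreeRel ρ (.comp h i s (.add t t')) (.add (.comp h i s t) (.comp h i s t'))
  | comp_smul_right {m n p : ℕ} (h : p + 1 = m + n) (i : Fin m) (c : K) (s : FreeTerm K E k m)
      (t : FreeTerm K E k n) :
      FreeRel ρ (.comp h i s (.smul c t)) (.smul c (.comp h i s t))
  | act_add {n : ℕ} (σ : Equiv.Perm (Fin n)) (s t : FreeTerm K E k n) :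
      FreeRel ρ (.act σ (.add s t)) (.add (.act σ s) (.act σ t))
  | act_smul {n : ℕ} (σ : Equiv.Perm (Fin n)) (c : K) (s : FreeTerm K E k n) :
      FreeRel ρ (.act σ (.smul c s)) (.smul c (.act σ s))
  -- operad laws
  | act_one {n : ℕ} (s : FreeTerm K E k n) : FreeRel ρ (.act 1 s) s
  | act_mul {n : ℕ} (σ τ : Equiv.Perm (Fin n)) (s : FreeTerm K E k n) :
      FreeRel ρ (.act (σ * τ) s) (.act τ (.act σ s))
  | comp_unit {m : ℕ} (h : m + 1 = m + 1) (i : Fin m) (s : FreeTerm K E k m) :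
      FreeRel ρ (.comp h i s .unit) s
  | unit_comp {n : ℕ} (h : n + 1 = 1 + n) (s : FreeTerm K E k n) :
      FreeRel ρ (.comp h 0 .unit s) s
  | sequential {m n r p q s : ℕ} (h₁ : p + 1 = m + n) (h₂ : s + 1 = p + r)
      (h₃ : q + 1 = n + r) (h₄ : s + 1 = m + q) (i : Fin m) (l : Fin n)
      (x : FreeTerm K E k m) (y : FreeTerm K E k n) (z : FreeTerm K E k r) :
      FreeRel ρ (.comp h₂ (innerPos h₁ i l) (.comp h₁ i x y) z)
        (.comp h₄ i x (.comp h₃ l y z))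
  | parallel {m n r p q s : ℕ} (h₁ : p + 1 = m + n) (h₂ : s + 1 = p + r)
      (h₃ : q + 1 = m + r) (h₄ : s + 1 = q + n) (i j : Fin m) (hij : i ≠ j)
      (x : FreeTerm K E k m) (y : FreeTerm K E k n) (z : FreeTerm K E k r) :
      FreeRel ρ (.comp h₂ (outerPos h₁ i j hij.symm) (.comp h₁ i x y) z)
        (.comp h₄ (outerPos h₃ j i hij) (.comp h₃ j x z) y)
  | equivariant {m n p : ℕ} (h : p + 1 = m + n) (i : Fin m) (σ : Equiv.Perm (Fin m))
      (τ : Equiv.Perm (Fin n)) (s : FreeTerm K E k m) (t : FreeTerm K E k n) :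
      FreeRel ρ (.comp h i (.act σ s) (.act τ t)) (.act (blockPerm h i σ τ) (.comp h (σ i) s t))
  -- the structure of `E`
  | gen_add (e e' : E) : FreeRel ρ (.gen (e + e')) (.add (.gen e) (.gen e'))
  | gen_smul (c : K) (e : E) : FreeRel ρ (.gen (c • e)) (.smul c (.gen e))
  | gen_act (σ : Equiv.Perm (Fin k)) (e : E) : FreeRel ρ (.gen (ρ (op σ) e)) (.act σ (.gen e))

/-- Congruence of formal expressions. -/
def freeSetoid {K : Type u} [Field K] {E : Type v} [AddCommGroup E] [Module K E] {k : ℕ}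
    (ρ : Representation K (Equiv.Perm (Fin k))ᵐᵒᵖ E) (n : ℕ) : Setoid (FreeTerm K E k n) where
  r := FreeRel ρ
  iseqv := ⟨.refl, .symm, .trans⟩

/-- The arity `n` part of the free operad. -/
def FreeObj {K : Type u} [Field K] {E : Type v} [AddCommGroup E] [Module K E] {k : ℕ}
    (ρ : Representation K (Equiv.Perm (Fin k))ᵐᵒᵖ E) (n : ℕ) : Type (max u v) :=
  Quotient (freeSetoid ρ n)

section FreeObj

variable {K : Type u} [Field K] {E : Type v} [AddCommGroup E] [Module K E] {k : ℕ}
  (ρ : Representation K (Equiv.Perm (Fin k))ᵐᵒᵖ E)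

/-- The class of a formal expression. -/
def FreeObj.mk {n : ℕ} (t : FreeTerm K E k n) : FreeObj ρ n :=
  Quotient.mk (freeSetoid ρ n) t

variable {ρ} in
theorem FreeObj.sound {n : ℕ} {s t : FreeTerm K E k n} (h : FreeRel ρ s t) :
    FreeObj.mk ρ s = FreeObj.mk ρ t :=
  Quotient.sound (s := freeSetoid ρ n) h

instance FreeObj.instAdd (n : ℕ) : Add (FreeObj ρ n) :=
  ⟨Quotient.map₂ .add fun _ _ h _ _ h' => .congr_add h h'⟩

instance FreeObj.instZero (n : ℕ) : Zero (FreeObj ρ n) :=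
  ⟨FreeObj.mk ρ (.zero n)⟩

instance FreeObj.instNeg (n : ℕ) : Neg (FreeObj ρ n) :=
  ⟨Quotient.map (.smul (-1)) fun _ _ h => .congr_smul (-1) h⟩

instance FreeObj.instAddCommGroup (n : ℕ) : AddCommGroup (FreeObj ρ n) where
  add_assoc := by
    rintro ⟨a⟩ ⟨b⟩ ⟨c⟩
    exact FreeObj.sound (.add_assoc a b c)
  add_comm := by
    rintro ⟨a⟩ ⟨b⟩
    exact FreeObj.sound (.add_comm a b)
  zero_add := by
    rintro ⟨a⟩
    exact FreeObj.sound (.zero_add a)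
  add_zero := by
    rintro ⟨a⟩
    exact FreeObj.sound (.trans (.add_comm _ _) (.zero_add a))
  neg_add_cancel := by
    rintro ⟨a⟩
    refine FreeObj.sound (.trans (.congr_add (.refl _) (.symm (.one_smul a))) (.trans
      (.symm (.add_smul (-1) 1 a)) ?_))
    rw [neg_add_cancel]
    exact .zero_smul a
  nsmul := nsmulRec
  zsmul := zsmulRec

instance FreeObj.instModule (n : ℕ) : Module K (FreeObj ρ n) where
  smul c := Quotient.map (.smul c) fun _ _ h => .congr_smul c h
  one_smul := by
    rintro ⟨a⟩
    exact FreeObj.sound (.one_smul a)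
  mul_smul := by
    rintro c d ⟨a⟩
    exact FreeObj.sound (.mul_smul c d a)
  smul_add := by
    rintro c ⟨a⟩ ⟨b⟩
    exact FreeObj.sound (.smul_add c a b)
  smul_zero := by
    intro c
    refine FreeObj.sound (.trans (.congr_smul c (.symm (.zero_smul (.zero n)))) (.trans
      (.symm (.mul_smul c 0 _)) ?_))
    rw [mul_zero]
    exact .zero_smul _
  add_smul := by
    rintro c d ⟨a⟩
    exact FreeObj.sound (.add_smul c d a)
  zero_smul := by
    rintro ⟨a⟩
    exact FreeObj.sound (.zero_smul a)

/-- The free operad `𝕋(E)` on a right `𝕊ₖ`-module `E`, that is, on the `𝕊`-module that is `E` in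
arity `k` and zero in all other arities. Its universal property is `freeOperad_existsUnique`. -/
def freeOperad : SymmOperad.{u, max u v} K where
  obj := FreeObj ρ
  act n :=
    { toFun := fun σ =>
        { toFun := Quotient.map (.act (unop σ)) fun _ _ h => .congr_act (unop σ) h
          map_add' := by
            rintro ⟨a⟩ ⟨b⟩
            exact FreeObj.sound (.act_add _ a b)
          map_smul' := by
            rintro c ⟨a⟩
            exact FreeObj.sound (.act_smul _ c a) }
      map_one' := by
        refine LinearMap.ext ?_
        rintro ⟨a⟩
        exact FreeObj.sound (.act_one a)
      map_mul' := by
        intro σ τ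
        refine LinearMap.ext ?_
        rintro ⟨a⟩
        exact FreeObj.sound (.act_mul (unop τ) (unop σ) a) }
  unit := FreeObj.mk ρ .unit
  comp h i := LinearMap.mk₂ K
    (Quotient.map₂ (.comp h i) fun _ _ h₁ _ _ h₂ => .congr_comp h i h₁ h₂)
    (by
      rintro ⟨a⟩ ⟨b⟩ ⟨c⟩
      exact FreeObj.sound (.comp_add_left h i a b c))
    (by
      rintro c ⟨a⟩ ⟨b⟩
      exact FreeObj.sound (.comp_smul_left h i c a b))
    (by
      rintro ⟨a⟩ ⟨b⟩ ⟨c⟩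
      exact FreeObj.sound (.comp_add_right h i a b c))
    (by
      rintro c ⟨a⟩ ⟨b⟩
      exact FreeObj.sound (.comp_smul_right h i c a b))
  comp_unit := by
    rintro m h i ⟨a⟩
    exact FreeObj.sound (.comp_unit h i a)
  unit_comp := by
    rintro n h ⟨a⟩
    exact FreeObj.sound (.unit_comp h a)
  sequential := by
    rintro m n r p q s h₁ h₂ h₃ h₄ i l ⟨a⟩ ⟨b⟩ ⟨c⟩
    exact FreeObj.sound (.sequential h₁ h₂ h₃ h₄ i l a b c)
  parallel := by
    rintro m n r p q s h₁ h₂ h₃ h₄ i j hij ⟨a⟩ ⟨b⟩ ⟨c⟩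
    exact FreeObj.sound (.parallel h₁ h₂ h₃ h₄ i j hij a b c)
  equivariant := by
    rintro m n p h i σ τ ⟨a⟩ ⟨b⟩
    exact FreeObj.sound (.equivariant h i σ τ a b)

/-- The canonical map `E → 𝕋(E)(k)`. -/
def freeGen : E →ₗ[K] (freeOperad ρ).obj k where
  toFun e := FreeObj.mk ρ (.gen e)
  map_add' e e' := FreeObj.sound (.gen_add e e')
  map_smul' c e := FreeObj.sound (.gen_smul c e)

theorem freeGen_act (σ : Equiv.Perm (Fin k)) (e : E) :
    freeGen ρ (ρ (op σ) e) = (freeOperad ρ).act k (op σ) (freeGen ρ e) :=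
  FreeObj.sound (.gen_act σ e)

end FreeObj

/-- The value of a formal expression in an operad. -/
def FreeTerm.eval {K : Type u} [Field K] {E : Type v} [AddCommGroup E] [Module K E] {k : ℕ}
    (Q : SymmOperad.{u, w} K) (f : E →ₗ[K] Q.obj k) : ∀ {n : ℕ}, FreeTerm K E k n → Q.obj n
  | _, .gen e => f e
  | _, .unit => Q.unit
  | _, .comp h i s t => Q.comp h i (s.eval Q f) (t.eval Q f)
  | n, .act σ t => Q.act n (op σ) (t.eval Q f)
  | _, .zero _ => 0
  | _, .add s t => s.eval Q f + t.eval Q f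
  | _, .smul c t => c • t.eval Q f

theorem FreeRel.eval_eq {K : Type u} [Field K] {E : Type v} [AddCommGroup E] [Module K E] {k : ℕ}
    {ρ : Representation K (Equiv.Perm (Fin k))ᵐᵒᵖ E} (Q : SymmOperad.{u, w} K)
    (f : E →ₗ[K] Q.obj k) (hf : ∀ σ e, f (ρ (op σ) e) = Q.act k (op σ) (f e)) {n : ℕ}
    {s t : FreeTerm K E k n} (h : FreeRel ρ s t) : s.eval Q f = t.eval Q f := by
  induction h with
  | refl => rfl
  | symm _ ih => exact ih.symm
  | trans _ _ ih ih' => exact ih.trans ih'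
  | sequential => simp only [FreeTerm.eval]; apply Q.sequential
  | parallel => simp only [FreeTerm.eval]; apply Q.parallel
  | equivariant => simp only [FreeTerm.eval]; apply Q.equivariant
  | gen_act σ e => exact hf σ e
  | add_comm => simp only [FreeTerm.eval]; apply _root_.add_comm
  | add_assoc => simp only [FreeTerm.eval]; apply _root_.add_assoc
  | comp_unit => simp only [FreeTerm.eval]; apply Q.comp_unit
  | unit_comp => simp only [FreeTerm.eval]; apply Q.unit_comp
  | mul_smul => simp only [FreeTerm.eval]; apply SemigroupAction.mul_smul
  | add_smul => simp only [FreeTerm.eval]; apply _root_.add_smul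
  | _ => simp_all [FreeTerm.eval]

/-- The universal property of the free operad. -/
theorem freeOperad_existsUnique {K : Type u} [Field K] {E : Type v} [AddCommGroup E] [Module K E]
    {k : ℕ} (ρ : Representation K (Equiv.Perm (Fin k))ᵐᵒᵖ E) (Q : SymmOperad.{u, w} K)
    (f : E →ₗ[K] Q.obj k) (hf : ∀ σ e, f (ρ (op σ) e) = Q.act k (op σ) (f e)) :
    ∃! F : OperadHom (freeOperad ρ) Q, ∀ e, F.map k (freeGen ρ e) = f e := by
  refine ⟨
    { map := fun n =>
        { toFun := Quotient.lift (fun t => t.eval Q f) fun _ _ h => h.eval_eq Q f hf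
          map_add' := by rintro ⟨a⟩ ⟨b⟩; rfl
          map_smul' := by rintro c ⟨a⟩; rfl }
      map_unit := rfl
      map_comp := by rintro m n p h i ⟨a⟩ ⟨b⟩; rfl
      map_act := by rintro n σ ⟨a⟩; rfl }, fun e => rfl, ?_⟩
  intro F hF
  suffices H : ∀ {n : ℕ} (t : FreeTerm K E k n), F.map n (FreeObj.mk ρ t) = t.eval Q f by
    obtain ⟨map, _, _, _⟩ := F
    congr 1
    funext n
    refine LinearMap.ext ?_
    rintro ⟨t⟩
    exact H t
  intro n t
  induction t with
  | gen e => exact hF e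
  | unit => exact F.map_unit
  | comp h i s t ihs iht =>
    rw [FreeTerm.eval, ← ihs, ← iht]
    exact F.map_comp h i (FreeObj.mk ρ s) (FreeObj.mk ρ t)
  | act σ t ih =>
    rw [FreeTerm.eval, ← ih]
    exact F.map_act σ (FreeObj.mk ρ t)
  | zero n => exact (F.map n).map_zero
  | add s t ihs iht =>
    rw [FreeTerm.eval, ← ihs, ← iht]
    exact (F.map _).map_add (FreeObj.mk ρ s) (FreeObj.mk ρ t)
  | smul c t ih =>
    rw [FreeTerm.eval, ← ih]
    exact (F.map _).map_smul c (FreeObj.mk ρ t)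

/-! ### Operadic ideals and quotients -/

/-- An operadic ideal. -/
structure OperadIdeal {K : Type u} [Field K] (P : SymmOperad.{u, v} K) where
  carrier : ∀ n, Submodule K (P.obj n)
  act_mem : ∀ {n : ℕ} (σ : Equiv.Perm (Fin n)) (μ : P.obj n),
    μ ∈ carrier n → P.act n (op σ) μ ∈ carrier n
  comp_mem_left : ∀ {m n p : ℕ} (h : p + 1 = m + n) (i : Fin m) (μ : P.obj m) (ν : P.obj n),
    μ ∈ carrier m → P.comp h i μ ν ∈ carrier p
  comp_mem_right : ∀ {m n p : ℕ} (h : p + 1 = m + n) (i : Fin m) (μ : P.obj m) (ν : P.obj n),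
    ν ∈ carrier n → P.comp h i μ ν ∈ carrier p

/-- The operadic ideal `(R)` generated by a set `R` of operations of arity `d`. -/
def idealGeneratedBy {K : Type u} [Field K] (P : SymmOperad.{u, v} K) {d : ℕ}
    (R : Set (P.obj d)) : OperadIdeal P where
  carrier n := ⨅ I : {I : OperadIdeal P // R ⊆ I.carrier d}, I.1.carrier n
  act_mem σ μ hμ := by
    rw [Submodule.mem_iInf] at hμ ⊢
    exact fun I => I.1.act_mem σ μ (hμ I)
  comp_mem_left h i μ ν hμ := by
    rw [Submodule.mem_iInf] at hμ ⊢
    exact fun I => I.1.comp_mem_left h i μ ν (hμ I)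
  comp_mem_right h i μ ν hν := by
    rw [Submodule.mem_iInf] at hν ⊢
    exact fun I => I.1.comp_mem_right h i μ ν (hν I)

/-- The quotient of an operad by an operadic ideal. -/
def quotientOperad {K : Type u} [Field K] (P : SymmOperad.{u, v} K) (I : OperadIdeal P) :
    SymmOperad.{u, v} K where
  obj n := P.obj n ⧸ I.carrier n
  act n :=
    { toFun := fun σ => (I.carrier n).mapQ (I.carrier n) (P.act n σ) fun μ hμ =>
        I.act_mem (unop σ) μ hμ
      map_one' := by
        refine Submodule.linearMap_qext _ (LinearMap.ext fun μ => ?_)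
        simp
      map_mul' := fun σ τ => by
        refine Submodule.linearMap_qext _ (LinearMap.ext fun μ => ?_)
        simp only [map_mul]
        rfl }
  unit := (I.carrier 1).mkQ P.unit
  comp {m n p} h i :=
    (I.carrier m).liftQ
      { toFun := fun μ => (I.carrier n).mapQ (I.carrier p) (P.comp h i μ) fun ν hν =>
          I.comp_mem_right h i μ ν hν
        map_add' := fun μ μ' => by
          refine Submodule.linearMap_qext _ (LinearMap.ext fun ν => ?_)
          simp
        map_smul' := fun c μ => by
          refine Submodule.linearMap_qext _ (LinearMap.ext fun ν => ?_)
          simp }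
      fun μ hμ => by
        rw [LinearMap.mem_ker]
        refine Submodule.linearMap_qext _ (LinearMap.ext fun ν => ?_)
        exact (Submodule.Quotient.mk_eq_zero _).2 (I.comp_mem_left h i μ ν hμ)
  comp_unit := by
    rintro m h i ⟨μ⟩
    exact congrArg (I.carrier m).mkQ (P.comp_unit h i μ)
  unit_comp := by
    rintro n h ⟨ν⟩
    exact congrArg (I.carrier n).mkQ (P.unit_comp h ν)
  sequential := by
    rintro m n r p q s h₁ h₂ h₃ h₄ i l ⟨μ⟩ ⟨ν⟩ ⟨ξ⟩
    exact congrArg (I.carrier s).mkQ (P.sequential h₁ h₂ h₃ h₄ i l μ ν ξ)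
  parallel := by
    rintro m n r p q s h₁ h₂ h₃ h₄ i j hij ⟨μ⟩ ⟨ν⟩ ⟨ξ⟩
    exact congrArg (I.carrier s).mkQ (P.parallel h₁ h₂ h₃ h₄ i j hij μ ν ξ)
  equivariant := by
    rintro m n p h i σ τ ⟨μ⟩ ⟨ν⟩
    exact congrArg (I.carrier p).mkQ (P.equivariant h i σ τ μ ν)

/-- The `k`-ary quadratic operad `𝕋(E)/(R)` with generators a right `𝕊ₖ`-module `E` in arity `k`
and relations `R ⊆ 𝕋(E)(2k - 1)`. -/
def quadraticOperad {K : Type u} [Field K] {E : Type v} [AddCommGroup E] [Module K E] {k : ℕ}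
    (ρ : Representation K (Equiv.Perm (Fin k))ᵐᵒᵖ E)
    (R : Submodule K ((freeOperad ρ).obj (2 * k - 1))) : SymmOperad.{u, max u v} K :=
  quotientOperad (freeOperad ρ) (idealGeneratedBy (freeOperad ρ) (R : Set ((freeOperad ρ).obj (2 * k - 1))))

/-- The canonical map `E → 𝕋(E)(k) → P(k)`, for `P = 𝕋(E)/(R)`. -/
def quadraticGen {K : Type u} [Field K] {E : Type v} [AddCommGroup E] [Module K E] {k : ℕ}
    (ρ : Representation K (Equiv.Perm (Fin k))ᵐᵒᵖ E)
    (R : Submodule K ((freeOperad ρ).obj (2 * k - 1))) :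
    E →ₗ[K] (quadraticOperad ρ R).obj k :=
  ((idealGeneratedBy (freeOperad ρ)
    (R : Set ((freeOperad ρ).obj (2 * k - 1)))).carrier k).mkQ.comp (freeGen ρ)

/-! ### Algebras over an operad and their universal polynomials -/

/-- A `P`-algebra structure on the vector space `A`: a morphism of operads from `P` to the
endomorphism operad of `A`. -/
abbrev OperadAlgebra {K : Type u} [Field K] (P : SymmOperad.{u, v} K) (A : Type w)
    [AddCommGroup A] [Module K A] :=
  OperadHom P (endOperad K A)

/-- The operation `γ(μ) : Aᵏ → A` of a `P`-algebra. -/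
def OperadAlgebra.operation {K : Type u} [Field K] {P : SymmOperad.{u, v} K} {A : Type w}
    [AddCommGroup A] [Module K A] (γ : OperadAlgebra P A) {k : ℕ} (μ : P.obj k) :
    MultilinearMap K (fun _ : Fin k => A) A :=
  γ.map k μ

/-- The structure constant `α^s_{γ(μ), i₁, …, iₖ}`: the coefficient of `a_s` in
`γ(μ)(a_{i₁}, …, a_{iₖ})`. -/
noncomputable def structureConst {K : Type u} [Field K] {P : SymmOperad.{u, v} K} {A : Type w}
    [AddCommGroup A] [Module K A] (γ : OperadAlgebra P A) {n : ℕ} (b : Module.Basis (Fin n) K A)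
    {k : ℕ} (μ : P.obj k) (i : Fin k → Fin n) (s : Fin n) : K :=
  b.repr (γ.operation μ fun j => b (i j)) s

/-- The universal polynomial
`∑ᵤ α^u_{γ(μ), i₁, …, iₖ} X_{au} - ∑_{s₁, …, sₖ} α^a_{γ(μ), s₁, …, sₖ} X_{s₁i₁} ⋯ X_{sₖiₖ}`. -/
noncomputable def universalPolynomial {K : Type u} [Field K] {P : SymmOperad.{u, v} K}
    {A : Type w} [AddCommGroup A] [Module K A] (γ : OperadAlgebra P A) {n : ℕ}
    (b : Module.Basis (Fin n) K A) {k : ℕ} (μ : P.obj k) (a : Fin n) (i : Fin k → Fin n) :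
    MvPolynomial (Fin n × Fin n) K :=
  ∑ u, MvPolynomial.C (structureConst γ b μ i u) * MvPolynomial.X (a, u) -
    ∑ s : Fin k → Fin n,
      MvPolynomial.C (structureConst γ b μ s a) * ∏ j, MvPolynomial.X (s j, i j)

/-- The ideal `J` of `K[X_{si}]` generated by the universal polynomials of all operations of all
arities. -/
noncomputable def universalIdeal {K : Type u} [Field K] {P : SymmOperad.{u, v} K}
    {A : Type w} [AddCommGroup A] [Module K A] (γ : OperadAlgebra P A) {n : ℕ}
    (b : Module.Basis (Fin n) K A) : Ideal (MvPolynomial (Fin n × Fin n) K) :=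
  Ideal.span {f | ∃ (k : ℕ) (μ : P.obj k) (a : Fin n) (i : Fin k → Fin n),
    f = universalPolynomial γ b μ a i}

/-- The universal algebra `C(A) = K[X_{si}] / J`. -/
abbrev UniversalAlgebra {K : Type u} [Field K] {P : SymmOperad.{u, v} K}
    {A : Type w} [AddCommGroup A] [Module K A] (γ : OperadAlgebra P A) {n : ℕ}
    (b : Module.Basis (Fin n) K A) :=
  MvPolynomial (Fin n × Fin n) K ⧸ universalIdeal γ b

/-! Let `J` be the ideal generated by the polynomials of a basis of `P(k)`, and let `C` be the
polynomial ring modulo `J`. The generic matrix defines a linear map `φ : A → Cⁿ`, where `Cⁿ` stands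
for `A ⊗ C`. All polynomials of an operation `μ` lie in `J` exactly when `φ` carries `γ(μ)` to its
`C`-multilinear extension: the two sums in a universal polynomial are the coordinates of the two
sides on basis vectors (`mem_compatibleOperations_genericMap_iff`). The operations with this
property form a suboperad: the condition is linear in `μ`, holds for the unit, and survives
composition and permutation of inputs, because extension of scalars respects all of these
(`extendScalars_endComp`, `extendScalars_domDomCongr`). This suboperad contains a basis of `P(k)`,
and `P` is generated by `P(k)`, so it is all of `P`.

The bijection of `E` with `P(k)` rests on counting arities. For `k ≥ 2`, a composite of arity at
most `k` in the free operad involves at most one generator, so `E` maps onto arity `k`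
(`freeGen_surjective`). For injectivity, `truncatedOperad` has only `K` in arity `1` and `E` in
arity `k`. The free operad maps to it, and the relations die there because `2k - 1` is neither `1`
nor `k`, while `E` survives (`quadraticGen_injective`). -/

/-! ### Base change of multilinear operations -/

section BaseChange

variable {K A C : Type*} [Field K] [AddCommGroup A] [Module K A] [CommRing C] [Algebra K C]
  {n : ℕ} (b : Module.Basis (Fin n) K A)

/-- The map `A → Cⁿ` that takes coordinates in the basis `b`. -/
noncomputable def coordMap (C : Type*) [CommRing C] [Algebra K C] : A →ₗ[K] (Fin n → C) :=
  b.constr K fun u => Pi.single u 1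

theorem coordMap_basis (u : Fin n) :
    coordMap b C (b u) = Pi.single u 1 := by
  simp [coordMap]

theorem coordMap_apply (v : A) (a : Fin n) :
    coordMap b C v a = algebraMap K C (b.repr v a) := by
  simp [coordMap, Module.Basis.constr_apply_fintype, Pi.single_apply, Algebra.smul_def]

/-- The extension of a multilinear operation on `A` to `Cⁿ`. -/
noncomputable def extendScalars (C : Type*) [CommRing C] [Algebra K C] {m : ℕ}
    (f : MultilinearMap K (fun _ : Fin m => A) A) :
    MultilinearMap C (fun _ : Fin m => Fin n → C) (Fin n → C) :=
  ∑ s : Fin m → Fin n, ((MultilinearMap.mkPiAlgebra C (Fin m) C).compLinearMap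
    fun j => LinearMap.proj (s j)).smulRight (coordMap b C (f fun j => b (s j)))

theorem extendScalars_apply {m : ℕ} (f : MultilinearMap K (fun _ : Fin m => A) A)
    (w : Fin m → Fin n → C) :
    extendScalars b C f w =
      ∑ s : Fin m → Fin n, (∏ j, w j (s j)) • coordMap b C (f fun j => b (s j)) := by
  simp [extendScalars]

theorem extendScalars_single {m : ℕ} (f : MultilinearMap K (fun _ : Fin m => A) A)
    (s : Fin m → Fin n) :
    extendScalars b C f (fun j => Pi.single (s j) 1) = coordMap b C (f fun j => b (s j)) := by
  rw [extendScalars_apply, Finset.sum_eq_single s]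
  · simp
  · intro t _ ht
    obtain ⟨j, hj⟩ := Function.ne_iff.1 ht
    rw [Finset.prod_eq_zero (Finset.mem_univ j), zero_smul]
    simp [hj]
  · simp

/-- A `C`-multilinear map on `Cⁿ` is determined by its values on unit vectors. This uniqueness
replaces explicit sums in the proofs that extension respects the operad structure. -/
theorem eq_extendScalars {m : ℕ} (f : MultilinearMap K (fun _ : Fin m => A) A)
    (F : MultilinearMap C (fun _ : Fin m => Fin n → C) (Fin n → C))
    (h : ∀ s : Fin m → Fin n, F (fun j => Pi.single (s j) 1) = coordMap b C (f fun j => b (s j))) :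
    F = extendScalars b C f := by
  refine Module.Basis.ext_multilinear (fun _ => Pi.basisFun C (Fin n)) fun s => ?_
  simp only [Pi.basisFun_apply]
  rw [h, extendScalars_single]

/-- Both sides are `K`-multilinear in `v` and agree on the basis `b`. Thus `coordMap`, which plays
the role of `A → A ⊗ C`, intertwines each operation with its extension. -/
theorem extendScalars_coordMap {m : ℕ} (f : MultilinearMap K (fun _ : Fin m => A) A)
    (v : Fin m → A) :
    extendScalars b C f (fun j => coordMap b C (v j)) = coordMap b C (f v) := by
  have : ((extendScalars b C f).restrictScalars K).compLinearMap (fun _ => coordMap b C) =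
      (coordMap b C).compMultilinearMap f := by
    refine Module.Basis.ext_multilinear (fun _ => b) fun s => ?_
    simp only [MultilinearMap.compLinearMap_apply, LinearMap.compMultilinearMap_apply,
      coordMap_basis]
    exact extendScalars_single b f s
  exact congrArg (fun F => F v) this

/-- Partial composition of multilinear maps over a commutative ring. -/
def ringComp {B : Type*} [AddCommGroup B] [Module C B] {m n p : ℕ}
    (h : p + 1 = m + n) (i : Fin m) (f : MultilinearMap C (fun _ : Fin m => B) B)
    (g : MultilinearMap C (fun _ : Fin n => B) B) : MultilinearMap C (fun _ : Fin p => B) B :=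
  MultilinearMap.mk' (fun v => f (endArgs h i g v))
    (by
      intro v q x y
      rcases exists_pos h i q with ⟨l, rfl⟩ | ⟨j, hj, rfl⟩
      · simp only [endArgs_update_inner, MultilinearMap.map_update_add]
      · simp only [endArgs_update_outer, MultilinearMap.map_update_add])
    (by
      intro v q c x
      rcases exists_pos h i q with ⟨l, rfl⟩ | ⟨j, hj, rfl⟩
      · simp only [endArgs_update_inner, MultilinearMap.map_update_smul]
      · simp only [endArgs_update_outer, MultilinearMap.map_update_smul])

/-- A map that intertwines the inner operations also intertwines the argument lists of the
composites. It serves both for `coordMap` and for an arbitrary compatible `φ`. -/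
theorem map_endArgs {A B : Type*} (φ : A → B) {m n p : ℕ} (h : p + 1 = m + n) (i : Fin m)
    (g : (Fin n → A) → A) (g' : (Fin n → B) → B) (v : Fin p → A)
    (hg : ∀ w, φ (g w) = g' fun l => φ (w l)) (j : Fin m) :
    φ (endArgs h i g v j) = endArgs h i g' (fun q => φ (v q)) j := by
  by_cases hj : j = i
  · subst hj
    rw [endArgs_same, endArgs_same, hg]
  · rw [endArgs_ne _ _ _ _ _ hj, endArgs_ne _ _ _ _ _ hj]

/-- By uniqueness it suffices to compare on unit vectors. These come from `A` under `coordMap`,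
which intertwines both `f` and `g` with their extensions. -/
theorem extendScalars_endComp {m r p : ℕ} (h : p + 1 = m + r) (i : Fin m)
    (f : MultilinearMap K (fun _ : Fin m => A) A) (g : MultilinearMap K (fun _ : Fin r => A) A) :
    extendScalars b C (endComp K h i f g) =
      ringComp h i (extendScalars b C f) (extendScalars b C g) := by
  refine (eq_extendScalars b _ _ fun s => ?_).symm
  rw [endComp_apply, ← extendScalars_coordMap]
  simp only [← coordMap_basis (C := C) b]
  change extendScalars b C f _ = _
  congr 1
  funext j
  exact (map_endArgs _ h i _ _ _ (fun w => (extendScalars_coordMap b g w).symm) j).symm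

theorem extendScalars_domDomCongr {m : ℕ} (σ : Equiv.Perm (Fin m))
    (f : MultilinearMap K (fun _ : Fin m => A) A) :
    extendScalars b C (f.domDomCongr σ) = (extendScalars b C f).domDomCongr σ := by
  refine (eq_extendScalars b _ _ fun s => ?_).symm
  exact extendScalars_single b f fun j => s (σ j)

theorem extendScalars_add {m : ℕ} (f g : MultilinearMap K (fun _ : Fin m => A) A) :
    extendScalars b C (f + g) = extendScalars b C f + extendScalars b C g := by
  refine (eq_extendScalars b _ _ fun s => ?_).symm
  simp [extendScalars_single]

theorem extendScalars_smul {m : ℕ} (c : K) (f : MultilinearMap K (fun _ : Fin m => A) A) :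
    extendScalars b C (c • f) = algebraMap K C c • extendScalars b C f := by
  refine (eq_extendScalars b _ _ fun s => ?_).symm
  simp [extendScalars_single]

/-! ### The suboperad of operations compatible with a linear map -/

/-- The operations of `P` with which the map `φ : A → Cⁿ` is compatible. -/
noncomputable def compatibleOperations {P : SymmOperad K} (γ : OperadAlgebra P A)
    (φ : A →ₗ[K] (Fin n → C)) (m : ℕ) : Submodule K (P.obj m) where
  carrier := {μ | ∀ v, φ (γ.operation μ v) =
    extendScalars b C (γ.operation μ) fun j => φ (v j)}
  zero_mem' v := by
    -- Writing zero as a scalar multiple reduces this case to `extendScalars_smul`.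
    have h : γ.operation (0 : P.obj m) = (0 : K) • γ.operation (0 : P.obj m) := by
      rw [zero_smul]; exact (γ.map m).map_zero
    rw [h, extendScalars_smul]
    simp
  add_mem' {μ ν} hμ hν v := by
    have h : γ.operation (μ + ν) = γ.operation μ + γ.operation ν := (γ.map m).map_add μ ν
    rw [h, extendScalars_add, add_apply, add_apply, map_add, hμ v, hν v]
  smul_mem' c μ hμ v := by
    have h : γ.operation (c • μ) = c • γ.operation μ := (γ.map m).map_smul c μ
    rw [h, extendScalars_smul, smul_apply, smul_apply, map_smul, hμ v, algebraMap_smul]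

section

variable {P : SymmOperad K} (γ : OperadAlgebra P A) (φ : A →ₗ[K] (Fin n → C))

theorem unit_mem_compatibleOperations : P.unit ∈ compatibleOperations b γ φ 1 := by
  intro v
  have h : γ.operation P.unit =
    MultilinearMap.ofSubsingleton K A A (0 : Fin 1) LinearMap.id := γ.map_unit
  -- The extension of the identity operation is the identity of `Cⁿ`, by its values on unit vectors.
  have h' : MultilinearMap.ofSubsingleton C (Fin n → C) (Fin n → C) (0 : Fin 1) LinearMap.id =
      extendScalars b C (γ.operation P.unit) := by
    refine eq_extendScalars b _ _ fun s => ?_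
    rw [h]
    exact (coordMap_basis b _).symm
  rw [← h', h]
  rfl

/-- The map `φ` passes first through the outer operation `μ`, then through `ν` inside the argument
at place `i`. -/
theorem comp_mem_compatibleOperations {m r p : ℕ} (h : p + 1 = m + r) (i : Fin m) {μ : P.obj m}
    {ν : P.obj r} (hμ : μ ∈ compatibleOperations b γ φ m)
    (hν : ν ∈ compatibleOperations b γ φ r) :
    P.comp h i μ ν ∈ compatibleOperations b γ φ p := by
  intro v
  have e : γ.operation (P.comp h i μ ν) = endComp K h i (γ.operation μ) (γ.operation ν) :=
    γ.map_comp h i μ ν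
  rw [e, extendScalars_endComp, endComp_apply, hμ]
  change _ = extendScalars b C (γ.operation μ) _
  congr 1
  funext j
  exact map_endArgs _ h i _ _ _ hν j

theorem act_mem_compatibleOperations {m : ℕ} (σ : Equiv.Perm (Fin m)) {μ : P.obj m}
    (hμ : μ ∈ compatibleOperations b γ φ m) :
    P.act m (op σ) μ ∈ compatibleOperations b γ φ m := by
  intro v
  have e : γ.operation (P.act m (op σ) μ) = (γ.operation μ).domDomCongr σ⁻¹ := γ.map_act σ μ
  rw [e, extendScalars_domDomCongr]
  exact hμ _

/-- Both sides of the condition are `K`-multilinear, so basis vectors suffice; this leaves finitely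
many equations, one for each choice of indices. -/
theorem mem_compatibleOperations_iff {m : ℕ} (μ : P.obj m) :
    μ ∈ compatibleOperations b γ φ m ↔ ∀ s : Fin m → Fin n,
      φ (γ.operation μ fun j => b (s j)) =
        extendScalars b C (γ.operation μ) fun j => φ (b (s j)) := by
  refine ⟨fun h s => h _, fun h v => ?_⟩
  have : φ.compMultilinearMap (γ.operation μ) =
      ((extendScalars b C (γ.operation μ)).restrictScalars K).compLinearMap (fun _ => φ) :=
    Module.Basis.ext_multilinear (fun _ => b) h
  exact congrArg (fun F => F v) this

end

/-! ### The generic matrix and the universal polynomials -/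

/-- The map `a_i ↦ ∑ₛ x_{si} a_s`. -/
noncomputable def matrixMap (x : Fin n × Fin n → C) : A →ₗ[K] (Fin n → C) :=
  b.constr K fun u a => x (a, u)

theorem matrixMap_basis (x : Fin n × Fin n → C) (u a : Fin n) :
    matrixMap b x (b u) a = x (a, u) := by
  rw [matrixMap, Module.Basis.constr_basis]

theorem matrixMap_apply (x : Fin n × Fin n → C) (v : A) (a : Fin n) :
    matrixMap b x v a = ∑ u, algebraMap K C (b.repr v u) * x (a, u) := by
  simp [matrixMap, Module.Basis.constr_apply_fintype, Algebra.smul_def]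

theorem extendScalars_matrixMap (x : Fin n × Fin n → C) {m : ℕ}
    (f : MultilinearMap K (fun _ : Fin m => A) A) (i : Fin m → Fin n) (a : Fin n) :
    extendScalars b C f (fun j => matrixMap b x (b (i j))) a =
      ∑ s : Fin m → Fin n, algebraMap K C (b.repr (f fun j => b (s j)) a) *
        ∏ j, x (s j, i j) := by
  simp [extendScalars_apply, matrixMap_basis, coordMap_apply, mul_comm]

/-- The map given by the generic matrix `X`, with coefficients modulo `J`. -/
noncomputable def genericMap (J : Ideal (MvPolynomial (Fin n × Fin n) K)) :
    A →ₗ[K] (Fin n → MvPolynomial (Fin n × Fin n) K ⧸ J) :=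
  matrixMap b fun q => Ideal.Quotient.mk J (MvPolynomial.X q)

/-- On basis vectors, the `a`-th coordinate of `φ(γ(μ)(…))` is the first sum of the universal
polynomial modulo `J`, and that of the extended operation applied to the images under `φ` is the
second. Their equality says that the difference lies in `J`. -/
theorem mem_compatibleOperations_genericMap_iff {P : SymmOperad K} (γ : OperadAlgebra P A)
    (J : Ideal (MvPolynomial (Fin n × Fin n) K)) {m : ℕ} (μ : P.obj m) :
    μ ∈ compatibleOperations b γ (genericMap b J) m ↔
      ∀ (a : Fin n) (i : Fin m → Fin n), universalPolynomial γ b μ a i ∈ J := by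
  rw [mem_compatibleOperations_iff, forall_comm]
  refine forall_congr' fun i => ?_
  rw [funext_iff]
  refine forall_congr' fun a => ?_
  have hC (c : K) : Ideal.Quotient.mk J (MvPolynomial.C c) =
      algebraMap K (MvPolynomial (Fin n × Fin n) K ⧸ J) c := rfl
  rw [← Ideal.Quotient.eq_zero_iff_mem, universalPolynomial, map_sub, sub_eq_zero]
  simp only [genericMap, matrixMap_apply, extendScalars_matrixMap, map_sum, map_mul, map_prod, hC,
    structureConst]

end BaseChange

/-! ### The free operad in arities at most `k` -/

section LowArity

variable {K E : Type*} [Field K] [AddCommGroup E] [Module K E] {k : ℕ}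
  (ρ : Representation K (Equiv.Perm (Fin k))ᵐᵒᵖ E)

/-- Membership in families of subspaces of the free operad that contain the generators and are
closed under the operations. -/
theorem freeOperad_induction (S : ∀ n, Submodule K ((freeOperad ρ).obj n))
    (gen : ∀ e, freeGen ρ e ∈ S k) (unit : (freeOperad ρ).unit ∈ S 1)
    (comp : ∀ {m n p : ℕ} (h : p + 1 = m + n) (i : Fin m) (μ : (freeOperad ρ).obj m)
      (ν : (freeOperad ρ).obj n), μ ∈ S m → ν ∈ S n → (freeOperad ρ).comp h i μ ν ∈ S p)
    (act : ∀ {n : ℕ} (σ : Equiv.Perm (Fin n)) (μ : (freeOperad ρ).obj n),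
      μ ∈ S n → (freeOperad ρ).act n (op σ) μ ∈ S n) {n : ℕ} (μ : (freeOperad ρ).obj n) :
    μ ∈ S n := by
  obtain ⟨t, rfl⟩ : ∃ t, FreeObj.mk ρ t = μ := Quotient.exists_rep μ
  induction t with
  | gen e => exact gen e
  | unit => exact unit
  | comp h i s t ihs iht => exact comp h i _ _ ihs iht
  | act σ t ih => exact act σ _ ih
  | zero n => exact (S n).zero_mem
  | add s t ihs iht => exact (S _).add_mem ihs iht
  | smul c t ih => exact (S _).smul_mem c ih

/-- The span of the unit in arity `1`, the generators in arity `k`, and zero in the other arities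
below `k`. -/
def lowAritySpan (n : ℕ) : Submodule K ((freeOperad ρ).obj n) where
  -- Conditions special to arity `1` or `k` are stated with `≍`, since `n` is a variable here;
  -- substituting the arity turns them into plain equations. Nothing is required above `k`.
  carrier := {μ | (n < k → n ≠ 1 → μ = 0) ∧
    (n = 1 → ∃ c : K, μ ≍ c • (freeOperad ρ).unit) ∧
    (n = k → ∃ e : E, μ ≍ freeGen ρ e)}
  zero_mem' := by
    refine ⟨fun _ _ => rfl, ?_, ?_⟩
    · rintro rfl
      exact ⟨0, heq_of_eq (zero_smul K _).symm⟩
    · rintro rfl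
      exact ⟨0, heq_of_eq (map_zero (freeGen ρ)).symm⟩
  add_mem' := by
    rintro μ ν ⟨h₁, h₂, h₃⟩ ⟨h₁', h₂', h₃'⟩
    refine ⟨fun h h' => by rw [h₁ h h', h₁' h h', add_zero], ?_, ?_⟩
    · rintro rfl
      obtain ⟨c, ⟨⟩⟩ := h₂ rfl
      obtain ⟨d, ⟨⟩⟩ := h₂' rfl
      exact ⟨c + d, heq_of_eq (add_smul c d _).symm⟩
    · rintro rfl
      obtain ⟨c, ⟨⟩⟩ := h₃ rfl
      obtain ⟨d, ⟨⟩⟩ := h₃' rfl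
      exact ⟨c + d, heq_of_eq ((freeGen ρ).map_add c d).symm⟩
  smul_mem' := by
    rintro a μ ⟨h₁, h₂, h₃⟩
    refine ⟨fun h h' => by rw [h₁ h h', smul_zero], ?_, ?_⟩
    · rintro rfl
      obtain ⟨c, ⟨⟩⟩ := h₂ rfl
      exact ⟨a * c, heq_of_eq (SemigroupAction.mul_smul a c _).symm⟩
    · rintro rfl
      obtain ⟨c, ⟨⟩⟩ := h₃ rfl
      exact ⟨a • c, heq_of_eq ((freeGen ρ).map_smul a c).symm⟩

/-- A factor of arity one is a multiple of the unit, so it only rescales the other factor. If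
neither factor has arity one, a composite of arity at most `k` has a factor in a vanishing arity,
possibly arity zero. -/
theorem comp_mem_lowAritySpan (hk : 2 ≤ k) {m n p : ℕ} (h : p + 1 = m + n) (i : Fin m)
    (μ : (freeOperad ρ).obj m) (ν : (freeOperad ρ).obj n) (hμ : μ ∈ lowAritySpan ρ m)
    (hν : ν ∈ lowAritySpan ρ n) : (freeOperad ρ).comp h i μ ν ∈ lowAritySpan ρ p := by
  by_cases hp : k < p
  · exact ⟨fun _ => by omega, fun _ => by omega, fun _ => by omega⟩
  have hm : 0 < m := i.pos
  by_cases hn1 : n = 1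
  · subst hn1
    obtain ⟨c, ⟨⟩⟩ := hν.2.1 rfl
    obtain rfl : p = m := by omega
    simp only [map_smul, (freeOperad ρ).comp_unit]
    exact Submodule.smul_mem _ c hμ
  by_cases hm1 : m = 1
  · subst hm1
    obtain ⟨c, ⟨⟩⟩ := hμ.2.1 rfl
    obtain rfl : p = n := by omega
    obtain rfl : i = 0 := Subsingleton.elim _ _
    simp only [map_smul, LinearMap.smul_apply, (freeOperad ρ).unit_comp]
    exact Submodule.smul_mem _ c hν
  -- Now `p ≤ k` and neither arity is one. Either `ν` vanishes, or `n ≥ k` and `p + 1 = m + n` force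
  -- `m ≤ 1`, which is already excluded.
  by_cases hnk : n < k
  · rw [hν.1 hnk hn1, map_zero]
    exact Submodule.zero_mem _
  · rw [hμ.1 (by omega) hm1, map_zero, LinearMap.zero_apply]
    exact Submodule.zero_mem _

/-- The condition `k ≥ 2` keeps the unit and the generators in different arities, so each meets only
its own clause of `lowAritySpan`. -/
theorem mem_lowAritySpan (hk : 2 ≤ k) {n : ℕ} (μ : (freeOperad ρ).obj n) :
    μ ∈ lowAritySpan ρ n := by
  refine freeOperad_induction ρ (lowAritySpan ρ) ?_ ?_ (comp_mem_lowAritySpan ρ hk) ?_ μ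
  · exact fun e => ⟨fun _ => by omega, fun _ => by omega, fun _ => ⟨e, HEq.rfl⟩⟩
  · exact ⟨fun _ _ => by omega, fun _ => ⟨1, heq_of_eq (one_smul K _).symm⟩, fun _ => by omega⟩
  · rintro n σ μ ⟨h₁, h₂, h₃⟩
    refine ⟨fun h h' => by rw [h₁ h h', map_zero], ?_, ?_⟩
    · rintro rfl
      obtain rfl : σ = 1 := Subsingleton.elim _ _
      simpa using h₂ rfl
    · rintro rfl
      obtain ⟨e, ⟨⟩⟩ := h₃ rfl
      exact ⟨ρ (op σ) e, heq_of_eq (freeGen_act ρ σ e).symm⟩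

theorem freeGen_surjective (hk : 2 ≤ k) : Function.Surjective (freeGen ρ) := fun μ =>
  ((mem_lowAritySpan ρ hk μ).2.2 rfl).imp fun _ h => (eq_of_heq h).symm

end LowArity

/-! ### The operad with trivial composition of generators -/

section Truncated

variable {K E : Type*} [Field K] [AddCommGroup E] [Module K E] {k : ℕ}
  (ρ : Representation K (Equiv.Perm (Fin k))ᵐᵒᵖ E)

/-- The representation `ρ` in arity `k`, and the trivial one in the other arities. -/
noncomputable def arityAction (n : ℕ) : Representation K (Equiv.Perm (Fin n))ᵐᵒᵖ E :=
  -- The choice of `1` is immaterial: outside arity `k` the `E`-component of `truncatedObj` is zero.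
  if h : n = k then by subst h; exact ρ else 1

theorem arityAction_self : arityAction ρ k = ρ := by
  simp [arityAction]

/-- `K` in arity `1`, `E` in arity `k`, and zero in the other arities. -/
def truncatedObj (K E : Type*) [Field K] [AddCommGroup E] [Module K E] (k n : ℕ) :
    Submodule K (K × E) where
  -- All arities are subspaces of the same `K × E`, so the operad laws become identities there,
  -- without transport between arities.
  carrier := {x | (n ≠ 1 → x.1 = 0) ∧ (n ≠ k → x.2 = 0)}
  zero_mem' := ⟨fun _ => rfl, fun _ => rfl⟩
  add_mem' h h' := ⟨fun e => by simp [h.1 e, h'.1 e], fun e => by simp [h.2 e, h'.2 e]⟩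
  smul_mem' c _ h := ⟨fun e => by simp [h.1 e], fun e => by simp [h.2 e]⟩

/-- The action on `K` in arity `1` and on `E` in arity `k`. -/
noncomputable def truncatedAct (n : ℕ) :
    Representation K (Equiv.Perm (Fin n))ᵐᵒᵖ (truncatedObj K E k n) where
  toFun σ := (LinearMap.prodMap LinearMap.id (arityAction ρ n σ)).restrict fun x hx =>
    ⟨hx.1, fun e => by simp [hx.2 e]⟩
  map_one' := by
    ext x <;> simp
  map_mul' σ τ := by
    refine LinearMap.ext fun x => Subtype.ext (Prod.ext rfl ?_)
    exact congrArg (fun g : E →ₗ[K] E => g x.1.2) (map_mul (arityAction ρ n) σ τ)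

/-- Partial composition in which the composite of two generators is zero. -/
def truncatedComp {m n p : ℕ} (h : p + 1 = m + n) (i : Fin m) :
    truncatedObj K E k m →ₗ[K] truncatedObj K E k n →ₗ[K] truncatedObj K E k p :=
  -- This is the product of the square-zero extension `K ⊕ E`, independent of the place `i`. Its
  -- associativity and commutativity give the laws `sequential` and `parallel`.
  LinearMap.mk₂ K (fun x y => ⟨(x.1.1 * y.1.1, y.1.1 • x.1.2 + x.1.1 • y.1.2), by
      have hm := i.pos
      obtain ⟨⟨c, u⟩, hc, hu⟩ := x
      obtain ⟨⟨d, v⟩, hd, hv⟩ := y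
      simp only at hc hu hd hv ⊢
      refine ⟨fun hp => ?_, fun hp => ?_⟩
      · by_cases hm1 : m = 1
        · simp [hd (by omega)]
        · simp [hc hm1]
      · have h₁ : d • u = 0 := by
          by_cases hn1 : n = 1
          · rw [hu (by omega), smul_zero]
          · rw [hd hn1, zero_smul]
        have h₂ : c • v = 0 := by
          by_cases hm1 : m = 1
          · rw [hv (by omega), smul_zero]
          · rw [hc hm1, zero_smul]
        simp [h₁, h₂]⟩)
    (fun x x' y => by ext <;> simp [add_mul, add_smul]; abel)
    (fun c x y => by
      refine Subtype.ext (Prod.ext (mul_assoc _ _ _) ?_)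
      change y.1.1 • c • x.1.2 + (c * x.1.1) • y.1.2 = c • (y.1.1 • x.1.2 + x.1.1 • y.1.2)
      module)
    (fun x y y' => by ext <;> simp [mul_add, add_smul]; abel)
    (fun c x y => by
      refine Subtype.ext (Prod.ext (mul_left_comm _ _ _) ?_)
      change (c * y.1.1) • x.1.2 + x.1.1 • c • y.1.2 = c • (y.1.1 • x.1.2 + x.1.1 • y.1.2)
      module)

theorem truncatedComp_coe {m n p : ℕ} (h : p + 1 = m + n) (i : Fin m)
    (x : truncatedObj K E k m) (y : truncatedObj K E k n) :
    (truncatedComp h i x y : K × E) = (x.1.1 * y.1.1, y.1.1 • x.1.2 + x.1.1 • y.1.2) := rfl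

theorem truncatedAct_coe {n : ℕ} (σ : (Equiv.Perm (Fin n))ᵐᵒᵖ) (x : truncatedObj K E k n) :
    (truncatedAct ρ n σ x : K × E) = (x.1.1, arityAction ρ n σ x.1.2) := rfl

/-- Inserting a block of length one renumbers no input. With `blockPerm_one_left`, this gives
equivariance whenever one factor is a multiple of the unit. -/
theorem blockPerm_one_right {m : ℕ} (h : m + 1 = m + 1) (i : Fin m) (σ : Equiv.Perm (Fin m))
    (τ : Equiv.Perm (Fin 1)) : blockPerm h i σ τ = σ := by
  have inner (j : Fin m) (l : Fin 1) : innerPos h j l = j := Fin.ext (by simp [innerPos])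
  have outer (j j' : Fin m) (hj : j' ≠ j) : outerPos h j j' hj = j' :=
    Fin.ext (by simp [outerPos])
  refine Equiv.ext fun j => ?_
  by_cases hj : j = i
  · subst hj
    have := blockPerm_inner h j σ τ 0
    rwa [inner, inner] at this
  · have := blockPerm_outer h i σ τ j hj
    rwa [outer, outer] at this

theorem blockPerm_one_left {n : ℕ} (h : n + 1 = 1 + n) (i : Fin 1) (σ : Equiv.Perm (Fin 1))
    (τ : Equiv.Perm (Fin n)) : blockPerm h i σ τ = τ := by
  have inner (j : Fin 1) (l : Fin n) : innerPos h j l = l := Fin.ext (by simp [innerPos])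
  refine Equiv.ext fun l => ?_
  have := blockPerm_inner h i σ τ l
  rwa [inner, inner] at this

/-- The operad that is `K` in arity `1`, `E` in arity `k`, and zero in the other arities. -/
noncomputable def truncatedOperad : SymmOperad K where
  obj n := truncatedObj K E k n
  act := truncatedAct ρ
  unit := ⟨(1, 0), fun h => absurd rfl h, fun _ => rfl⟩
  comp h i := truncatedComp h i
  comp_unit h i x := by
    apply Subtype.ext
    simp [truncatedComp_coe]
  unit_comp h y := by
    apply Subtype.ext
    simp [truncatedComp_coe]
  sequential h₁ h₂ h₃ h₄ i l x y z := by
    apply Subtype.ext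
    simp only [truncatedComp_coe, Prod.mk.injEq, smul_add, smul_smul]
    refine ⟨mul_assoc _ _ _, ?_⟩
    rw [mul_comm z.1.1 y.1.1, mul_comm z.1.1 x.1.1, add_assoc]
  parallel h₁ h₂ h₃ h₄ i j hij x y z := by
    apply Subtype.ext
    simp only [truncatedComp_coe, Prod.mk.injEq, smul_add, smul_smul]
    refine ⟨mul_right_comm _ _ _, ?_⟩
    rw [mul_comm z.1.1 y.1.1, mul_comm z.1.1 x.1.1, mul_comm y.1.1 x.1.1]
    abel
  equivariant {m n p} h i σ τ x y := by
    apply Subtype.ext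
    simp only [truncatedComp_coe, truncatedAct_coe, map_add, map_smul, Prod.mk.injEq, true_and]
    -- The first summand can be nonzero only for `n = 1`, where the block permutation is `σ`; the
    -- second only for `m = 1`, where it is `τ`.
    congr 1
    · by_cases hn : n = 1
      · subst hn
        obtain rfl : p = m := by omega
        rw [blockPerm_one_right]
      · rw [y.2.1 hn, zero_smul, zero_smul]
    · by_cases hm : m = 1
      · subst hm
        obtain rfl : p = n := by omega
        rw [blockPerm_one_left]
      · rw [x.2.1 hm, zero_smul, zero_smul]

/-- The inclusion of the generators. -/
def truncatedGen : E →ₗ[K] truncatedObj K E k k :=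
  (LinearMap.inr K K E).codRestrict _ fun _ => ⟨fun _ => rfl, fun h => absurd rfl h⟩

end Truncated

/-! ### Generators and induction in the quadratic operad -/

/-- The kernel of a morphism of operads. -/
def OperadHom.ker {K : Type*} [Field K] {P Q : SymmOperad K} (F : OperadHom P Q) :
    OperadIdeal P where
  carrier n := LinearMap.ker (F.map n)
  act_mem σ μ hμ := by
    rw [LinearMap.mem_ker] at hμ ⊢
    rw [F.map_act, hμ, map_zero]
  comp_mem_left h i μ ν hμ := by
    rw [LinearMap.mem_ker] at hμ ⊢
    rw [F.map_comp, hμ, map_zero, LinearMap.zero_apply]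
  comp_mem_right h i μ ν hν := by
    rw [LinearMap.mem_ker] at hν ⊢
    rw [F.map_comp, hν, map_zero]

section Quadratic

variable {K E : Type*} [Field K] [AddCommGroup E] [Module K E] {k : ℕ}
  (ρ : Representation K (Equiv.Perm (Fin k))ᵐᵒᵖ E)
  (R : Submodule K ((freeOperad ρ).obj (2 * k - 1)))

/-- The kernel of the map to `truncatedOperad` is an operadic ideal containing `R`, hence containing
`(R)`, yet it meets the image of `E` only in zero. -/
theorem quadraticGen_injective (hk : 2 ≤ k) : Function.Injective (quadraticGen ρ R) := by
  obtain ⟨F, hF, -⟩ := freeOperad_existsUnique ρ (truncatedOperad ρ) truncatedGen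
    (by
      intro σ e
      apply Subtype.ext
      change ((0 : K), ρ (op σ) e) = ((0 : K), arityAction ρ k (op σ) e)
      rw [arityAction_self])
  have hR : (R : Set ((freeOperad ρ).obj (2 * k - 1))) ⊆ F.ker.carrier (2 * k - 1) := by
    intro x _
    apply Subtype.ext
    have := (F.map (2 * k - 1) x).2
    -- Since `k ≥ 2`, the arity `2k - 1` is neither `1` nor `k`, so both components vanish.
    exact Prod.ext (this.1 (by omega)) (this.2 (by omega))
  rw [← LinearMap.ker_eq_bot, LinearMap.ker_eq_bot']
  intro e he
  have h₁ : freeGen ρ e ∈ (idealGeneratedBy (freeOperad ρ)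
      (R : Set ((freeOperad ρ).obj (2 * k - 1)))).carrier k :=
    (Submodule.Quotient.mk_eq_zero _).1 he
  -- The ideal `(R)` is the intersection of all ideals containing `R`, and the kernel is one of
  -- them.
  have h₂ : freeGen ρ e ∈ F.ker.carrier k := (Submodule.mem_iInf _).1 h₁ ⟨F.ker, hR⟩
  have h₃ : (truncatedGen e : truncatedObj K E k k) = 0 := (hF e).symm.trans h₂
  exact congrArg (fun x : truncatedObj K E k k => x.1.2) h₃

theorem quadraticGen_bijective (hk : 2 ≤ k) : Function.Bijective (quadraticGen ρ R) :=
  ⟨quadraticGen_injective ρ R hk,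
    (Submodule.mkQ_surjective _).comp (freeGen_surjective ρ hk)⟩

/-- Membership in families of subspaces of a quadratic operad that contain the operations of
arity `k` and are closed under the operations. -/
theorem quadraticOperad_induction (S : ∀ n, Submodule K ((quadraticOperad ρ R).obj n))
    (gen : ∀ μ, μ ∈ S k) (unit : (quadraticOperad ρ R).unit ∈ S 1)
    (comp : ∀ {m n p : ℕ} (h : p + 1 = m + n) (i : Fin m) {μ : (quadraticOperad ρ R).obj m}
      {ν : (quadraticOperad ρ R).obj n}, μ ∈ S m → ν ∈ S n →
      (quadraticOperad ρ R).comp h i μ ν ∈ S p)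
    (act : ∀ {n : ℕ} (σ : Equiv.Perm (Fin n)) {μ : (quadraticOperad ρ R).obj n},
      μ ∈ S n → (quadraticOperad ρ R).act n (op σ) μ ∈ S n)
    {n : ℕ} (μ : (quadraticOperad ρ R).obj n) : μ ∈ S n := by
  obtain ⟨μ, rfl⟩ := Submodule.mkQ_surjective _ μ
  exact freeOperad_induction ρ (fun n => (S n).comap (Submodule.mkQ _)) (fun e => gen _) unit
    (fun h i _ _ hμ hν => comp h i hμ hν) (fun σ _ hμ => act σ hμ) μ

end Quadratic

theorem theorem5p3 {K : Type*} [Field K] [CharZero K] {k : ℕ} (hk : 2 ≤ k)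
    {E : Type*} [AddCommGroup E] [Module K E] (ρ : Representation K (Equiv.Perm (Fin k))ᵐᵒᵖ E)
    (R : Submodule K ((freeOperad ρ).obj (2 * k - 1)))
    (hR : ∀ (σ : Equiv.Perm (Fin (2 * k - 1))), ∀ x ∈ R,
      (freeOperad ρ).act (2 * k - 1) (op σ) x ∈ R)
    {A : Type*} [AddCommGroup A] [Module K A] (γ : OperadAlgebra (quadraticOperad ρ R) A)
    {n : ℕ} (b : Module.Basis (Fin n) K A)
    {κ : Type*} (e : Module.Basis κ K ((quadraticOperad ρ R).obj k)) :
    Function.Bijective (quadraticGen ρ R) ∧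
    universalIdeal γ b =
      Ideal.span {f | ∃ (x : κ) (a : Fin n) (i : Fin k → Fin n),
        f = universalPolynomial γ b (e x) a i} := by
  refine ⟨quadraticGen_bijective ρ R hk, le_antisymm ?_ ?_⟩
  · set J := Ideal.span {f | ∃ (x : κ) (a : Fin n) (i : Fin k → Fin n),
      f = universalPolynomial γ b (e x) a i} with hJ
    refine Ideal.span_le.2 ?_
    rintro _ ⟨m, μ, a, i, rfl⟩
    -- The claim becomes compatibility of `μ` with the generic matrix modulo the smaller ideal `J`,
    -- a property to which induction over `P` applies.
    refine (mem_compatibleOperations_genericMap_iff b γ J μ).1 ?_ a i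
    refine quadraticOperad_induction ρ R (compatibleOperations b γ (genericMap b J)) ?_
      (unit_mem_compatibleOperations b γ _) (comp_mem_compatibleOperations b γ _)
      (act_mem_compatibleOperations b γ _) μ
    -- Compatible operations form a subspace, so in arity `k` only basis elements need checking;
    -- their polynomials generate `J`.
    suffices h : (⊤ : Submodule K _) ≤ compatibleOperations b γ (genericMap b J) k from
      fun μ => h trivial
    rw [← e.span_eq, Submodule.span_le]
    rintro _ ⟨x, rfl⟩
    exact (mem_compatibleOperations_genericMap_iff b γ J (e x)).2 fun a i =>
      Ideal.subset_span ⟨x, a, i, rfl⟩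
  · refine Ideal.span_mono ?_
    rintro _ ⟨x, a, i, rfl⟩
    exact ⟨k, e x, a, i, rfl⟩
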